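/- Let $k\ge 3$ and let $f:(\mathbb R^2,0)\to(\mathbb R^3,0)$ be a $C^\infty$ map-germ which is a normal form of a Whitney umbrella, i.e. $$f(u,v)=\Bigl(u,\;uv+\sum_{i=3}^k\frac{b_i}{i!}v^i+O(u,v)^{k+1},\;\sum_{j=2}^k\sum_{i=0}^j\frac{a_{i,j-i}}{i!\,(j-i)!}u^iv^{j-i}+O(u,v)^{k+1}\Bigr),\qquad a_{02}>0 .$$ For small $r>0$ let $\hat\gamma(\theta)=f(r\cos\theta,r\sin\theta)$, and let $\tilde{\mathbf n}(r,\theta)$ be the unit normal vector $(f_u\times f_v)/|f_u\times f_v|$ at $(r\cos\theta,r\sin\theta)$. A prime denotes the derivative with respect to $\theta$. Put $\mathcal A(\theta)=\sqrt{\cos^2\theta+(a_{11}\cos\theta+a_{02}\sin\theta)^2}$. * Write $\hat\gamma'=l\,\mathbf e$ with $l=|\hat\gamma'|$ and $\mathbf e$ a unit vector, and let $\hat\kappa_2=l\kappa_2$, where $\kappa_2=\mathbf e'\cdot\tilde{\mathbf n}$ is the coefficient of $\tilde{\mathbf n}$ in $\mathbf e'$ with respect to the orthonormal frame $\mathbf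 e,\ -\mathbf e\times\tilde{\mathbf n},\ \tilde{\mathbf n}$. Put $$F_{\hat\kappa_2}(\theta)=\cos\theta\bigl(a_{02}\cos^2\theta+(2a_{02}+a_{20})\sin^2\theta\bigr).$$ * Let $\beta(r,\theta)=-\dfrac{\hat\gamma'\cdot\tilde{\mathbf n}'}{\tilde{\mathbf n}'\cdot\tilde{\mathbf n}'}$, so that $\hat\gamma+\beta\,\tilde{\mathbf n}$ is the striction curve of the ruled surface $(\theta,t)\mapsto\hat\gamma(\theta)+t\,\tilde{\mathbf n}(\theta)$. A function $F(\theta)$, not identically zero, is called a first term of $x(r,\theta)$ if there are an integer $i\ge0$ and a nowhere vanishing function $x_0(\theta)$ such that, for every $\theta$, $x(r,\theta)=F(\theta)x_0(\theta)r^i+O(r^{i+1})$ as $r\to0$, $r>0$. **Theorem.** Uniformly in $\theta\in\mathbb R$, as $r\to 0$, $r>0$, $$\hat\kappa_2(r,\theta)=\frac{F_{\hat\kappa_2}(\theta)}{\mathcal A(\theta)}r^2+O(r^3),\qquad \beta(r,\theta)=\frac{\cos\theta\bigl(a_{02}\cos^2\theta+(2a_{02}+a_{20})\sin^2\theta\bigr)\mathcal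 A(\theta)^3}{a_{02}^2}\,r^2+O(r^3).$$ In particular $F_{\hat\kappa_2}$ is a first term of $\hat\kappa_2$, and $\beta$ has a first term. For every first term $F_\beta$ of $\beta$ and every $\theta\in\mathbb R$, $$F_{\hat\kappa_2}(\theta)=0\iff F_\beta(\theta)=0 .$$ -/

import Mathlib

open scoped ContDiff Topology RealInnerProductSpace

noncomputable section

namespace WhitneyUmbrella

/-- Euclidean 3-space. -/
abbrev E3 : Type := EuclideanSpace ℝ (Fin 3)

/-- The cross product of `ℝ³`, on Euclidean space. -/
def cross (x y : E3) : E3 := WithLp.toLp 2 (crossProduct x.ofLp y.ofLp)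

/-- `f` is (a representative of) a smooth map germ `(ℝ², 0) → ℝ³` of the form
`(u, uv + B(v) + O(u,v)^{k+1}, ∑_{j=2}^k A_j(u,v) + O(u,v)^{k+1})`, where
`B(v) = ∑_{i=3}^k b_i v^i / i!`, `A_j(u,v) = ∑_{i=0}^j a_{i,j-i} u^i v^{j-i} / (i! (j-i)!)`
and `a_{02} > 0`: the normal form of a Whitney umbrella. -/
structure IsNormalForm (k : ℕ) (a : ℕ → ℕ → ℝ) (b : ℕ → ℝ) (f : ℝ × ℝ → E3) : Prop where
  smooth : ∃ U ∈ 𝓝 (0 : ℝ × ℝ), ContDiffOn ℝ ∞ f U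
  fst_eq : ∀ᶠ p in 𝓝 (0 : ℝ × ℝ), f p 0 = p.1
  snd_eq : (fun p : ℝ × ℝ =>
      f p 1 - (p.1 * p.2 + ∑ i ∈ Finset.Icc 3 k, b i / (i.factorial : ℝ) * p.2 ^ i))
        =O[𝓝 0] fun p => ‖p‖ ^ (k + 1)
  thd_eq : (fun p : ℝ × ℝ =>
      f p 2 - ∑ j ∈ Finset.Icc 2 k, ∑ i ∈ Finset.range (j + 1),
        a i (j - i) / ((i.factorial : ℝ) * ((j - i).factorial : ℝ)) * p.1 ^ i * p.2 ^ (j - i))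
        =O[𝓝 0] fun p => ‖p‖ ^ (k + 1)
  a02_pos : 0 < a 0 2

/-- The normal vector `f_u × f_v`. -/
def normal (f : ℝ × ℝ → E3) (p : ℝ × ℝ) : E3 :=
  cross (fderiv ℝ f p (1, 0)) (fderiv ℝ f p (0, 1))

/-- The unit normal vector `(f_u × f_v) / |f_u × f_v|` of `f` (at regular points). -/
def unitNormal (f : ℝ × ℝ → E3) (p : ℝ × ℝ) : E3 := ‖normal f p‖⁻¹ • normal f p

/-- Polar coordinates `(r, θ) ↦ (r cos θ, r sin θ)`; for fixed `r` this is the circle `γ`. -/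
def polar (r θ : ℝ) : ℝ × ℝ := (r * Real.cos θ, r * Real.sin θ)

/-- The curve `γ̂ = f ∘ γ` which goes around the umbrella. -/
def curve (f : ℝ × ℝ → E3) (r θ : ℝ) : E3 := f (polar r θ)

/-- The unit normal vector of `f` along the curve. -/
def normalAlong (f : ℝ × ℝ → E3) (r θ : ℝ) : E3 := unitNormal f (polar r θ)

/-- For a ruled surface `(t, β) ↦ γ(t) + β δ(t)`, the coefficient `β(t)` for which
`σ(t) = γ(t) + β(t) δ(t)` is the striction curve: `β = -(γ'⬝δ') / (δ'⬝δ')`. -/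
def strictionCoeff (γ δ : ℝ → E3) (t : ℝ) : ℝ :=
  -(⟪deriv γ t, deriv δ t⟫ / ⟪deriv δ t, deriv δ t⟫)

/-- The function `β(r, θ)`: the striction curve of the ruled surface generated by the unit normal
vector along the curve `γ̂` is `γ̂ + β ñ`. -/
def beta (f : ℝ × ℝ → E3) (r θ : ℝ) : ℝ := strictionCoeff (curve f r) (normalAlong f r) θ

/-- The function `l` in `γ' = l e`, with `e` a unit vector field along `γ`. -/
def speed (γ : ℝ → E3) (t : ℝ) : ℝ := ‖deriv γ t‖

/-- The unit vector field `e` in `γ' = l e`. -/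
def tangent (γ : ℝ → E3) (t : ℝ) : E3 := (speed γ t)⁻¹ • deriv γ t

/-- `κ₂` in the Frenet type formula `e' = κ₁ b + κ₂ n`, `b' = -κ₁ e + κ₃ n`, `n' = -κ₂ e - κ₃ b`
of the orthonormal frame `e, b = -e × n, n` along `γ`. -/
def kappa2 (γ n : ℝ → E3) (t : ℝ) : ℝ := ⟪deriv (tangent γ) t, n t⟫

/-- `κ̂₂ = l κ₂` for the frame given by the unit normal vector of `f` along the curve `γ̂`. -/
def kappaHat2 (f : ℝ × ℝ → E3) (r θ : ℝ) : ℝ :=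
  speed (curve f r) θ * kappa2 (curve f r) (normalAlong f r) θ

/-- `𝒜(θ) = √(cos² θ + (a₁₁ cos θ + a₀₂ sin θ)²)`. -/
def calA (a : ℕ → ℕ → ℝ) (θ : ℝ) : ℝ :=
  Real.sqrt (Real.cos θ ^ 2 + (a 1 1 * Real.cos θ + a 0 2 * Real.sin θ) ^ 2)

/-- `F_{κ̂₂}(θ) = cos θ (a₀₂ cos² θ + (2 a₀₂ + a₂₀) sin² θ)`. -/
def FkappaHat2 (a : ℕ → ℕ → ℝ) (θ : ℝ) : ℝ :=
  Real.cos θ * (a 0 2 * Real.cos θ ^ 2 + (2 * a 0 2 + a 2 0) * Real.sin θ ^ 2)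

/-- `F` is a first term of `x(r, θ)` as `r → 0`, `r > 0`: there are an exponent `i` and a nowhere
vanishing function `x₀` such that `x(r, θ) = F(θ) x₀(θ) r^i + O(r^{i+1})` for every `θ`.
That `F` is not the zero function makes `i` the leading exponent (the zero function would
otherwise be a first term of every function of higher order). The choice of `x₀` changes `F`
by a nowhere vanishing factor only. -/
def IsFirstTerm (x : ℝ → ℝ → ℝ) (F : ℝ → ℝ) : Prop :=
  F ≠ 0 ∧ ∃ (i : ℕ) (x₀ : ℝ → ℝ), (∀ θ, x₀ θ ≠ 0) ∧
    ∀ θ, (fun r : ℝ => x r θ - F θ * x₀ θ * r ^ i) =O[𝓝[>] 0] fun r => r ^ (i + 1)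

/-- `x(r, θ) = c(θ) r^i + O(r^{i+1})` as `r → 0`, `r > 0`, uniformly in `θ`. -/
def HasLeadingTerm (x : ℝ → ℝ → ℝ) (c : ℝ → ℝ) (i : ℕ) : Prop :=
  ∃ C r₀ : ℝ, 0 < r₀ ∧ ∀ r θ : ℝ, 0 < r → r < r₀ → |x r θ - c θ * r ^ i| ≤ C * r ^ (i + 1)

end WhitneyUmbrella

end

/-! Everything reduces to the unnormalised normal `N = f_u × f_v` along the circle. Since `γ̂'` is
orthogonal to `N`, differentiating `e · ñ = 0` gives `κ̂₂ = -γ̂' · ñ' = -(γ̂' · N') / |N|`: the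
derivative of `1 / |N|` only contributes a multiple of `N`. Hence `β = κ̂₂ / |ñ'|²`, where `|ñ'|² =
(|N|²|N'|² - (N · N')²) / |N|⁴` (`kappaHat2_eq`, `beta_eq`).

Only the 2-jet of `f` matters at leading order. With `w = a₁₁ cos θ + a₀₂ sin θ`, one has `N = r (0,
-w, cos θ) + O(r²)`, so `|N|²` starts with `𝒜² r²`. The Gram determinant of `N, N'` starts with the
square of the Wronskian of `w` and `cos θ`, which is the constant `a₀₂²`, times `r⁴`; and `γ̂' · N'`
starts with `-F r³`, `F = F_{κ̂₂}` (`lead_inner`). Dividing is legitimate uniformly in `θ` because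
`𝒜²` is bounded below by a positive constant (`exists_le_calA_sq`). The two leading coefficients
thus differ by the nowhere vanishing factor `𝒜⁴ / a₀₂²`, and first terms are unique up to such
factors (`HasLeadingTerm.eq_zero_iff`). -/

noncomputable section

open Filter Asymptotics

namespace WhitneyUmbrella

/-! ### Differentiating `O`-estimates at the origin. -/

section Taylor

variable {E F : Type*} [NormedAddCommGroup E] [NormedSpace ℝ E]
  [NormedAddCommGroup F] [NormedSpace ℝ F]

/-- Integrating a bound of order `n` on the derivative gives a bound of order `n + 1`. -/
lemma isBigO_pow_succ_of_fderiv {g : E → F} {n : ℕ}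
    (hd : ∀ᶠ p in 𝓝 (0 : E), DifferentiableAt ℝ g p) (h0 : g 0 = 0)
    (hg : fderiv ℝ g =O[𝓝 0] fun p => ‖p‖ ^ n) :
    g =O[𝓝 0] fun p => ‖p‖ ^ (n + 1) := by
  obtain ⟨C, hC⟩ := hg.bound
  obtain ⟨ε, hε, hb⟩ := Metric.eventually_nhds_iff_ball.1 (hd.and hC)
  refine IsBigO.of_bound C ?_
  filter_upwards [Metric.ball_mem_nhds (0 : E) hε] with p hp
  have hsub : Metric.closedBall (0 : E) ‖p‖ ⊆ Metric.ball 0 ε :=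
    Metric.closedBall_subset_ball (by simpa using hp)
  -- The constant of an `O`-bound may be negative; the bound at a point `p ≠ 0` forces `0 ≤ C`.
  have hC0 : 0 ≤ C ∨ p = 0 := by
    by_cases hp0 : p = 0
    · exact Or.inr hp0
    · left
      have h1 := (hb p hp).2
      have h2 : 0 < ‖p‖ ^ n := pow_pos (norm_pos_iff.2 hp0) n
      rw [Real.norm_of_nonneg h2.le] at h1
      exact nonneg_of_mul_nonneg_left ((norm_nonneg _).trans h1) h2
  rcases hC0 with hC0 | rfl
  · have := (convex_closedBall (0 : E) ‖p‖).norm_image_sub_le_of_norm_fderiv_le (𝕜 := ℝ)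
      (f := g) (C := C * ‖p‖ ^ n) (x := 0) (y := p) (fun x hx => (hb x (hsub hx)).1)
      (fun x hx => (hb x (hsub hx)).2.trans (by
        rw [norm_pow, norm_norm]
        have : ‖x‖ ≤ ‖p‖ := by simpa using hx
        gcongr)) (by simp) (by simp)
    rw [h0, sub_zero, sub_zero] at this
    rw [norm_pow, norm_norm, pow_succ, ← mul_assoc]
    exact this
  · simp [h0]

/-- The bound makes the derivative vanish at `0`, and a map differentiable at `0` and vanishing
there is `O(‖p‖)`. -/
lemma fderiv_isBigO_of_isBigO_sq {g : E → F} (hg : ContDiffAt ℝ 2 g 0)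
    (h : g =O[𝓝 0] fun p => ‖p‖ ^ 2) : fderiv ℝ g =O[𝓝 0] fun p => ‖p‖ := by
  have h0 : fderiv ℝ g 0 = 0 := by
    refine (IsBigO.hasFDerivAt (n := 2) ?_ one_lt_two).fderiv
    simpa using h
  have hd : DifferentiableAt ℝ (fderiv ℝ g) 0 :=
    (hg.fderiv_right (m := 1) (by norm_num)).differentiableAt (by norm_num)
  have := hd.isBigO_sub
  simp only [h0, sub_zero] at this
  exact this.norm_right

/-- The point is that the second derivative `L` at `0` vanishes. Integrating `g' = L + O(‖p‖²)`
gives `g(p) = L(p,p)/2 + O(‖p‖³)`, so the quadratic form is itself `O(‖p‖³)` and must be zero. -/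
lemma fderiv_isBigO_of_isBigO_cube {g : E → F} (hg : ContDiffAt ℝ 3 g 0)
    (h : g =O[𝓝 0] fun p => ‖p‖ ^ 3) : fderiv ℝ g =O[𝓝 0] fun p => ‖p‖ ^ 2 := by
  have hg0 : g 0 = 0 := IsBigO.eq_zero_of_norm_pow (n := 3) (by simpa using h) (by norm_num)
  have h0 : fderiv ℝ g 0 = 0 := by
    refine (IsBigO.hasFDerivAt (n := 3) ?_ (by norm_num)).fderiv
    simpa using h
  have hG : ContDiffAt ℝ 2 (fderiv ℝ g) 0 := hg.fderiv_right (by norm_num)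
  have hGd : ∀ᶠ p in 𝓝 (0 : E), DifferentiableAt ℝ (fderiv ℝ g) p :=
    ((hG.of_le (m := 1) (by norm_num)).eventually (by simp)).mono
      fun p hp => hp.differentiableAt (by norm_num)
  have hgd : ∀ᶠ p in 𝓝 (0 : E), DifferentiableAt ℝ g p :=
    ((hg.of_le (m := 1) (by norm_num)).eventually (by simp)).mono
      fun p hp => hp.differentiableAt (by norm_num)
  have hD : DifferentiableAt ℝ (fderiv ℝ (fderiv ℝ g)) 0 :=
    (hG.fderiv_right (m := 1) (by norm_num)).differentiableAt (by norm_num)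
  set L := fderiv ℝ (fderiv ℝ g) 0 with hL
  have hsymm : ∀ v w, L v w = L w v := hg.isSymmSndFDerivAt (by simp; norm_num)
  have hDO : (fun p => fderiv ℝ (fderiv ℝ g) p - L) =O[𝓝 0] fun p => ‖p‖ ^ 1 := by
    have h1 := DifferentiableAt.isBigO_sub (𝕜 := ℝ) (E := E) (F := E →L[ℝ] E →L[ℝ] F) hD
    simp only [sub_zero] at h1
    simpa only [pow_one] using h1.norm_right
  -- The first derivative agrees with `L` to second order.
  have hGL : (fun p => fderiv ℝ g p - L p) =O[𝓝 0] fun p => ‖p‖ ^ 2 := by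
    refine isBigO_pow_succ_of_fderiv (n := 1) ?_ (by simp [h0]) ?_
    · filter_upwards [hGd] with p hp using hp.sub L.differentiableAt
    · refine hDO.congr' ?_ EventuallyEq.rfl
      filter_upwards [hGd] with p hp
      rw [fderiv_fun_sub hp L.differentiableAt, L.fderiv]
  -- The function agrees with its quadratic part to third order.
  have hquad : ∀ p, HasFDerivAt (fun p => (1 / 2 : ℝ) • L p p) (L p) p := by
    intro p
    have h1 := (L.hasFDerivAt (x := p)).clm_apply (hasFDerivAt_id p)
    have h2 := h1.const_smul (1 / 2 : ℝ)
    refine h2.congr_fderiv ?_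
    ext v
    simp only [smul_apply, add_apply,
      ContinuousLinearMap.comp_apply, ContinuousLinearMap.id_apply,
      ContinuousLinearMap.flip_apply, id]
    rw [hsymm v p, ← two_smul ℝ, smul_smul]
    norm_num
  have hgq : (fun p => g p - (1 / 2 : ℝ) • L p p) =O[𝓝 0] fun p => ‖p‖ ^ 3 := by
    refine isBigO_pow_succ_of_fderiv (n := 2) ?_ (by simp [hg0]) ?_
    · filter_upwards [hgd] with p hp using hp.sub (hquad p).differentiableAt
    · refine hGL.congr' ?_ EventuallyEq.rfl
      filter_upwards [hgd] with p hp
      rw [fderiv_fun_sub hp (hquad p).differentiableAt, (hquad p).fderiv]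
  have hLO : (fun p => (1 / 2 : ℝ) • L p p) =O[𝓝 0] fun p => ‖p‖ ^ 3 := by
    simpa using h.sub hgq
  have hLO' : (fun p => L p p) =O[𝓝 0] fun p => ‖p‖ ^ 3 :=
    (isBigO_const_smul_left (by norm_num : (1 / 2 : ℝ) ≠ 0)).1 hLO
  -- Along the line `t • p` the form equals `t² L(p,p)`, which is `O(t³)`; divide by `t²`.
  have hdiag : ∀ p, L p p = 0 := by
    intro p
    have ht : Tendsto (fun t : ℝ => t • p) (𝓝[≠] 0) (𝓝 0) := by
      have : Tendsto (fun t : ℝ => t • p) (𝓝 0) (𝓝 ((0 : ℝ) • p)) :=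
        (continuous_id.smul continuous_const).tendsto 0
      rw [zero_smul] at this
      exact this.mono_left nhdsWithin_le_nhds
    have h1 := hLO'.comp_tendsto ht
    have h2 : (fun _ : ℝ => L p p) =O[𝓝[≠] 0] fun t : ℝ => t := by
      obtain ⟨C, hC⟩ := h1.bound
      refine IsBigO.of_bound (C * ‖p‖ ^ 3) ?_
      filter_upwards [hC, self_mem_nhdsWithin] with t ht ht0
      simp only [Function.comp_apply, map_smul, smul_apply, norm_smul,
        norm_pow, norm_mul, norm_norm] at ht
      have h3 : 0 < ‖t‖ := norm_pos_iff.2 ht0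
      have h4 : ‖t‖ ^ 2 * ‖L p p‖ ≤ ‖t‖ ^ 2 * (C * ‖p‖ ^ 3 * ‖t‖) := by
        calc _ = ‖t‖ * (‖t‖ * ‖L p p‖) := by ring
          _ ≤ C * (‖t‖ * ‖p‖) ^ 3 := ht
          _ = _ := by ring
      exact le_of_mul_le_mul_left h4 (by positivity)
    have h3 : Tendsto (fun _ : ℝ => L p p) (𝓝[≠] (0 : ℝ)) (𝓝 0) :=
      h2.trans_tendsto (tendsto_id.mono_left nhdsWithin_le_nhds)
    exact tendsto_nhds_unique tendsto_const_nhds h3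
  -- Polarization, using the symmetry of `L`.
  have hL0 : L = 0 := by
    ext v w
    have h1 := hdiag (v + w)
    simp only [map_add, add_apply, hdiag, zero_add, add_zero] at h1
    rw [hsymm w v, ← two_smul ℝ] at h1
    simpa using h1
  simpa [hL0] using hGL

end Taylor

/-! ### Arithmetic of leading terms, uniform in the angle. -/

/-- The filter of pairs `(r, θ)` with `r → 0`, `r > 0`, uniformly in `θ`. -/
def polarFilter : Filter (ℝ × ℝ) := 𝓝[>] 0 ×ˢ ⊤

lemma eventually_polarFilter {P : ℝ × ℝ → Prop} :
    (∀ᶠ q in polarFilter, P q) ↔ ∀ᶠ r in 𝓝[>] (0 : ℝ), ∀ θ, P (r, θ) := by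
  rw [polarFilter, ← principal_univ, eventually_prod_principal_iff]
  simp

lemma eventually_pos : ∀ᶠ q in polarFilter, 0 < q.1 :=
  eventually_polarFilter.2 (by filter_upwards [self_mem_nhdsWithin] with r hr _ using hr)

lemma tendsto_fst_polarFilter : Tendsto Prod.fst polarFilter (𝓝 (0 : ℝ)) :=
  tendsto_fst.mono_right nhdsWithin_le_nhds

lemma isBigO_pow_polarFilter {m n : ℕ} (h : m ≤ n) :
    (fun q : ℝ × ℝ => q.1 ^ n) =O[polarFilter] fun q => q.1 ^ m := by
  refine IsBigO.of_bound' ?_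
  filter_upwards [eventually_pos,
    tendsto_fst_polarFilter.eventually (Iio_mem_nhds one_pos)] with q h0 h1
  rw [norm_pow, norm_pow, Real.norm_of_nonneg h0.le]
  exact pow_le_pow_of_le_one h0.le (le_of_lt h1) h

/-- `x(r, θ) = c(θ) r^n + O(r^{n+1})` uniformly in `θ`, with a bounded coefficient `c`. -/
structure Lead (x : ℝ → ℝ → ℝ) (c : ℝ → ℝ) (n : ℕ) : Prop where
  bdd : ∃ C, ∀ θ, |c θ| ≤ C
  err : (fun q : ℝ × ℝ => x q.1 q.2 - c q.2 * q.1 ^ n) =O[polarFilter] fun q => q.1 ^ (n + 1)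

namespace Lead

variable {x y : ℝ → ℝ → ℝ} {c d : ℝ → ℝ} {m n : ℕ}

lemma coeff_isBigO (hc : ∃ C, ∀ θ, |c θ| ≤ C) :
    (fun q : ℝ × ℝ => c q.2) =O[polarFilter] fun _ => (1 : ℝ) := by
  obtain ⟨C, hC⟩ := hc
  exact IsBigO.of_bound C (Eventually.of_forall fun q => by simpa using hC q.2)

lemma main_isBigO (hc : ∃ C, ∀ θ, |c θ| ≤ C) :
    (fun q : ℝ × ℝ => c q.2 * q.1 ^ n) =O[polarFilter] fun q => q.1 ^ n := by
  simpa using (coeff_isBigO hc).mul (isBigO_refl (fun q : ℝ × ℝ => q.1 ^ n) polarFilter)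

lemma isBigO (h : Lead x c n) :
    (fun q : ℝ × ℝ => x q.1 q.2) =O[polarFilter] fun q => q.1 ^ n := by
  simpa using (h.err.trans (isBigO_pow_polarFilter n.le_succ)).add (main_isBigO h.bdd)

lemma congr' (h : Lead x c n) (hxy : ∀ᶠ q in polarFilter, x q.1 q.2 = y q.1 q.2)
    (hcd : ∀ θ, c θ = d θ) : Lead y d n := by
  obtain rfl : c = d := funext hcd
  refine ⟨h.bdd, h.err.congr' ?_ EventuallyEq.rfl⟩
  filter_upwards [hxy] with q hq using by rw [hq]

lemma congr (h : Lead x c n) (hcd : ∀ θ, c θ = d θ) : Lead x d n :=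
  h.congr' (Eventually.of_forall fun _ => rfl) hcd

/-- A quantity of order `n + 1` has leading term `0` at order `n`. -/
lemma lower (h : Lead x c (n + 1)) : Lead x (fun _ => 0) n :=
  ⟨⟨0, by simp⟩, by simpa using h.isBigO⟩

lemma coeff (hc : ∃ C, ∀ θ, |c θ| ≤ C) : Lead (fun _ θ => c θ) c 0 :=
  ⟨hc, by simpa using isBigO_zero _ _⟩

lemma radius : Lead (fun r _ => r) (fun _ => 1) 1 :=
  ⟨⟨1, by simp⟩, by simpa using isBigO_zero _ _⟩

lemma cos : Lead (fun _ θ => Real.cos θ) Real.cos 0 := coeff ⟨1, Real.abs_cos_le_one⟩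

lemma sin : Lead (fun _ θ => Real.sin θ) Real.sin 0 := coeff ⟨1, Real.abs_sin_le_one⟩

lemma add (hx : Lead x c n) (hy : Lead y d n) :
    Lead (fun r θ => x r θ + y r θ) (fun θ => c θ + d θ) n := by
  obtain ⟨C, hC⟩ := hx.bdd
  obtain ⟨D, hD⟩ := hy.bdd
  refine ⟨⟨C + D, fun θ => (abs_add_le _ _).trans (add_le_add (hC θ) (hD θ))⟩, ?_⟩
  refine (hx.err.add hy.err).congr_left fun q => ?_
  ring

lemma neg (hx : Lead x c n) : Lead (fun r θ => -x r θ) (fun θ => -c θ) n := by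
  refine ⟨by simpa using hx.bdd, hx.err.neg_left.congr_left fun q => ?_⟩
  ring

lemma sub (hx : Lead x c n) (hy : Lead y d n) :
    Lead (fun r θ => x r θ - y r θ) (fun θ => c θ - d θ) n := by
  simpa only [sub_eq_add_neg] using hx.add hy.neg

/-- Split the error as `(x - c rⁿ) y + c rⁿ (y - d rᵐ)`; boundedness of the coefficients keeps both
terms uniform. -/
lemma mul (hx : Lead x c n) (hy : Lead y d m) :
    Lead (fun r θ => x r θ * y r θ) (fun θ => c θ * d θ) (n + m) := by
  obtain ⟨C, hC⟩ := hx.bdd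
  obtain ⟨D, hD⟩ := hy.bdd
  refine ⟨⟨C * D, fun θ => ?_⟩, ?_⟩
  · rw [abs_mul]
    exact mul_le_mul (hC θ) (hD θ) (abs_nonneg _) ((abs_nonneg _).trans (hC θ))
  · have h1 := hx.err.mul hy.isBigO
    have h2 := (main_isBigO (n := n) hx.bdd).mul hy.err
    refine ((h1.congr_right fun q => ?_).add (h2.congr_right fun q => ?_)).congr_left
      fun q => ?_
    all_goals ring

lemma pow_two (hx : Lead x c n) : Lead (fun r θ => x r θ ^ 2) (fun θ => c θ ^ 2) (n + n) := by
  simpa only [sq] using hx.mul hx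

/-- A quantity whose leading coefficient is bounded below is eventually bounded below. -/
lemma eventually_ge (hx : Lead x c n) {δ : ℝ} (hδ : 0 < δ) (hc : ∀ θ, δ ≤ c θ) :
    ∀ᶠ q in polarFilter, δ / 2 * q.1 ^ n ≤ x q.1 q.2 := by
  obtain ⟨C, hC⟩ := hx.err.bound
  have hsmall : ∀ᶠ q : ℝ × ℝ in polarFilter, C * q.1 < δ / 2 := by
    have : Tendsto (fun q : ℝ × ℝ => C * q.1) polarFilter (𝓝 (C * 0)) :=
      tendsto_fst_polarFilter.const_mul C
    rw [mul_zero] at this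
    exact this.eventually (Iio_mem_nhds (half_pos hδ))
  filter_upwards [hC, hsmall, eventually_pos] with q h1 h2 h3
  have h4 : 0 < q.1 ^ n := pow_pos h3 n
  rw [Real.norm_eq_abs, Real.norm_of_nonneg (pow_pos h3 _).le, pow_succ] at h1
  have h5 := (abs_le.1 h1).1
  have h6 := mul_le_mul_of_nonneg_right (hc q.2) h4.le
  have h7 := mul_le_mul_of_nonneg_right h2.le h4.le
  linarith

lemma eventually_pos (hx : Lead x c n) {δ : ℝ} (hδ : 0 < δ) (hc : ∀ θ, δ ≤ c θ) :
    ∀ᶠ q in polarFilter, 0 < x q.1 q.2 := by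
  filter_upwards [hx.eventually_ge hδ hc, WhitneyUmbrella.eventually_pos] with q h1 h2
  exact lt_of_lt_of_le (by positivity) h1

/-- Over the common denominator `d y ≥ δ (δ/2) rⁿ`, the error has a numerator of order `m + n + 1`,
a combination of the errors of `x` and `y`. The uniform bound `δ` is essential here. -/
lemma div (hx : Lead x c (m + n)) (hy : Lead y d n) {δ : ℝ} (hδ : 0 < δ) (hd : ∀ θ, δ ≤ d θ) :
    Lead (fun r θ => x r θ / y r θ) (fun θ => c θ / d θ) m := by
  obtain ⟨C, hC⟩ := hx.bdd
  have hd0 : ∀ θ, 0 < d θ := fun θ => hδ.trans_le (hd θ)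
  refine ⟨⟨C / δ, fun θ => ?_⟩, ?_⟩
  · rw [abs_div, abs_of_pos (hd0 θ)]
    exact div_le_div₀ ((abs_nonneg _).trans (hC θ)) (hC θ) hδ (hd θ)
  · have hnum : (fun q : ℝ × ℝ => d q.2 * (x q.1 q.2 - c q.2 * q.1 ^ (m + n))
        - c q.2 * q.1 ^ m * (y q.1 q.2 - d q.2 * q.1 ^ n)) =O[polarFilter]
        fun q => q.1 ^ (m + n + 1) := by
      have h1 := (coeff_isBigO hy.bdd).mul hx.err
      have h2 := (main_isBigO (n := m) hx.bdd).mul hy.err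
      refine (h1.congr_right fun q => ?_).sub (h2.congr_right fun q => ?_)
      all_goals ring
    obtain ⟨K, hK⟩ := hnum.bound
    refine IsBigO.of_bound (K / (δ * (δ / 2))) ?_
    filter_upwards [hK, hy.eventually_ge hδ hd, WhitneyUmbrella.eventually_pos] with q h1 h2 h3
    have hy0 : 0 < y q.1 q.2 := lt_of_lt_of_le (by positivity) h2
    have hd' := hd0 q.2
    have heq : x q.1 q.2 / y q.1 q.2 - c q.2 / d q.2 * q.1 ^ m =
        (d q.2 * (x q.1 q.2 - c q.2 * q.1 ^ (m + n))
        - c q.2 * q.1 ^ m * (y q.1 q.2 - d q.2 * q.1 ^ n)) / (d q.2 * y q.1 q.2) := by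
      field_simp
      ring
    rw [heq, norm_div, Real.norm_of_nonneg (by positivity : 0 ≤ d q.2 * y q.1 q.2),
      div_le_iff₀ (by positivity)]
    refine h1.trans ?_
    rw [Real.norm_of_nonneg (by positivity), Real.norm_of_nonneg (by positivity)]
    have hK0 : 0 ≤ K := by
      have h4 := (norm_nonneg _).trans h1
      rw [Real.norm_of_nonneg (by positivity)] at h4
      exact nonneg_of_mul_nonneg_left h4 (by positivity)
    have h5 : δ * (δ / 2 * q.1 ^ n) ≤ d q.2 * y q.1 q.2 :=
      mul_le_mul (hd _) h2 (by positivity) hd'.le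
    calc K * q.1 ^ (m + n + 1)
        = K / (δ * (δ / 2)) * q.1 ^ (m + 1) * (δ * (δ / 2 * q.1 ^ n)) := by
          field_simp
          ring
      _ ≤ _ := by gcongr

/-- Factor the error of `x` as a difference of squares; the sum of the two roots is at least `√δ
rⁿ`. -/
lemma sqrt (hx : Lead x c (n + n)) {δ : ℝ} (hδ : 0 < δ) (hc : ∀ θ, δ ≤ c θ) :
    Lead (fun r θ => √(x r θ)) (fun θ => √(c θ)) n := by
  obtain ⟨C, hC⟩ := hx.bdd
  refine ⟨⟨√C, fun θ => ?_⟩, ?_⟩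
  · rw [abs_of_nonneg (Real.sqrt_nonneg _)]
    exact Real.sqrt_le_sqrt ((le_abs_self _).trans (hC θ))
  · obtain ⟨K, hK⟩ := hx.err.bound
    refine IsBigO.of_bound (K / √δ) ?_
    filter_upwards [hK, hx.eventually_pos hδ hc, WhitneyUmbrella.eventually_pos] with q h1 h2 h3
    have hc0 : 0 < c q.2 := hδ.trans_le (hc q.2)
    have hs : √δ ≤ √(c q.2) := Real.sqrt_le_sqrt (hc q.2)
    have hδ' : 0 < √δ := Real.sqrt_pos.2 hδ
    have hden : √δ * q.1 ^ n ≤ √(x q.1 q.2) + √(c q.2) * q.1 ^ n := by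
      have := mul_le_mul_of_nonneg_right hs (pow_pos h3 n).le
      have := Real.sqrt_nonneg (x q.1 q.2)
      linarith
    have hfac : x q.1 q.2 - c q.2 * q.1 ^ (n + n) =
        (√(x q.1 q.2) - √(c q.2) * q.1 ^ n) * (√(x q.1 q.2) + √(c q.2) * q.1 ^ n) := by
      have e1 := Real.sq_sqrt h2.le
      have e2 := Real.sq_sqrt hc0.le
      rw [pow_add]
      linear_combination -e1 + (q.1 ^ n) ^ 2 * e2
    rw [hfac, norm_mul, Real.norm_of_nonneg (r := _ + _) (by positivity),
      Real.norm_of_nonneg (r := q.1 ^ _) (by positivity)] at h1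
    rw [Real.norm_of_nonneg (r := q.1 ^ _) (by positivity)]
    have h4 : ‖√(x q.1 q.2) - √(c q.2) * q.1 ^ n‖ * (√δ * q.1 ^ n) ≤
        (K / √δ * q.1 ^ (n + 1)) * (√δ * q.1 ^ n) :=
      (mul_le_mul_of_nonneg_left hden (norm_nonneg _)).trans (h1.trans_eq (by
        field_simp
        ring))
    exact le_of_mul_le_mul_right h4 (by positivity)

lemma hasLeadingTerm (hx : Lead x c n) : HasLeadingTerm x c n := by
  obtain ⟨C, hC⟩ := hx.err.bound
  obtain ⟨ε, hε, h⟩ := Metric.eventually_nhds_iff.1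
    (eventually_nhdsWithin_iff.1 (eventually_polarFilter.1 hC))
  refine ⟨C, ε, hε, fun r θ h0 h1 => ?_⟩
  have := h (by simpa [abs_of_pos h0] using h1) h0 θ
  rwa [Real.norm_eq_abs, Real.norm_of_nonneg (pow_pos h0 _).le] at this

end Lead

/-! ### Uniqueness of leading terms. -/

lemma HasLeadingTerm.isBigO {x : ℝ → ℝ → ℝ} {c : ℝ → ℝ} {n : ℕ} (h : HasLeadingTerm x c n)
    (θ : ℝ) : (fun r : ℝ => x r θ - c θ * r ^ n) =O[𝓝[>] 0] fun r => r ^ (n + 1) := by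
  obtain ⟨C, r₀, hr₀, h⟩ := h
  refine IsBigO.of_bound C ?_
  filter_upwards [Ioo_mem_nhdsGT hr₀] with r hr
  rw [Real.norm_eq_abs, Real.norm_of_nonneg (pow_pos hr.1 _).le]
  exact h r θ hr.1 hr.2

/-- Two expansions of the same function cannot have different leading orders. -/
lemma coeff_eq_zero_of_lt {x : ℝ → ℝ} {c d : ℝ} {m n : ℕ} (hmn : m < n)
    (hm : (fun r : ℝ => x r - c * r ^ m) =O[𝓝[>] 0] fun r => r ^ (m + 1))
    (hn : (fun r : ℝ => x r - d * r ^ n) =O[𝓝[>] 0] fun r => r ^ (n + 1)) : c = 0 := by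
  have hpow : ∀ {k l : ℕ}, k ≤ l → (fun r : ℝ => r ^ l) =O[𝓝[>] 0] fun r => r ^ k := by
    intro k l hkl
    refine IsBigO.of_bound' ?_
    filter_upwards [Ioo_mem_nhdsGT one_pos] with r hr
    rw [norm_pow, norm_pow, Real.norm_of_nonneg hr.1.le]
    exact pow_le_pow_of_le_one hr.1.le hr.2.le hkl
  have h1 : (fun r : ℝ => x r) =O[𝓝[>] 0] fun r => r ^ (m + 1) := by
    simpa using (hn.trans (hpow (by lia))).add
      (((hpow (k := m + 1) hmn)).const_mul_left d)
  have h2 : (fun r : ℝ => c * r ^ m) =O[𝓝[>] 0] fun r => r ^ (m + 1) := by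
    simpa using h1.sub hm
  obtain ⟨C, hC⟩ := h2.bound
  have h3 : (fun _ : ℝ => c) =O[𝓝[>] 0] fun r : ℝ => r := by
    refine IsBigO.of_bound C ?_
    filter_upwards [hC, self_mem_nhdsWithin] with r hr h0
    rw [norm_mul, pow_succ, norm_mul, ← mul_assoc, mul_right_comm] at hr
    exact le_of_mul_le_mul_right hr (norm_pos_iff.2 (pow_pos h0 m).ne')
  have h4 : Tendsto (fun _ : ℝ => c) (𝓝[>] (0 : ℝ)) (𝓝 0) :=
    h3.trans_tendsto (tendsto_id.mono_left nhdsWithin_le_nhds)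
  exact tendsto_nhds_unique tendsto_const_nhds h4

/-- Subtracting expands the zero function at order `n` with coefficient `c - d`; it also has an
expansion at order `n + 1`. -/
lemma coeff_eq {x : ℝ → ℝ} {c d : ℝ} {n : ℕ}
    (h : (fun r : ℝ => x r - c * r ^ n) =O[𝓝[>] 0] fun r => r ^ (n + 1))
    (h' : (fun r : ℝ => x r - d * r ^ n) =O[𝓝[>] 0] fun r => r ^ (n + 1)) : c = d := by
  refine sub_eq_zero.1 (coeff_eq_zero_of_lt (x := fun _ => 0) (c := c - d) (d := 0)
    n.lt_succ_self ?_ (by simpa using isBigO_zero _ _))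
  refine (h.sub h').congr_left fun r => ?_
  ring

/-- The first term of a function with a leading term is unique up to a nowhere vanishing
factor. -/
lemma HasLeadingTerm.eq_zero_iff {x : ℝ → ℝ → ℝ} {G F : ℝ → ℝ} {n : ℕ}
    (h : HasLeadingTerm x G n) (hG : G ≠ 0) (hF : IsFirstTerm x F) (θ : ℝ) :
    G θ = 0 ↔ F θ = 0 := by
  obtain ⟨hF0, i, x₀, hx₀, hi⟩ := hF
  obtain ⟨θ₁, h1⟩ := Function.ne_iff.1 hG
  obtain ⟨θ₂, h2⟩ := Function.ne_iff.1 hF0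
  -- If the orders differ, the coefficient at the lower order vanishes for every angle, which fails
  -- at `θ₂` (for `F`) or at `θ₁` (for `G`).
  rcases lt_trichotomy i n with hlt | rfl | hlt
  · exact absurd (coeff_eq_zero_of_lt hlt (hi θ₂) (h.isBigO θ₂)) (mul_ne_zero h2 (hx₀ θ₂))
  · rw [coeff_eq (h.isBigO θ) (hi θ), mul_eq_zero, or_iff_left (hx₀ θ)]
  · exact absurd (coeff_eq_zero_of_lt hlt (h.isBigO θ₁) (hi θ₁)) h1

/-! ### Curves with a normalised normal field. -/

section Frame

variable {γ n N : ℝ → E3} {N' : E3} {θ : ℝ}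

/-- `l κ₂ = -γ' ⬝ n'` for a unit normal field `n` along `γ`. -/
lemma speed_mul_kappa2 (hγ : DifferentiableAt ℝ (deriv γ) θ) (h0 : deriv γ θ ≠ 0)
    (hn : DifferentiableAt ℝ n θ) (horth : ∀ t, ⟪deriv γ t, n t⟫ = 0) :
    speed γ θ * kappa2 γ n θ = -⟪deriv γ θ, deriv n θ⟫ := by
  have hs : speed γ θ ≠ 0 := norm_ne_zero_iff.2 h0
  have ht : DifferentiableAt ℝ (tangent γ) θ := ((hγ.norm ℝ h0).inv hs).smul hγ
  have h1 := (ht.hasDerivAt.inner ℝ hn.hasDerivAt).deriv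
  have h2 : (fun t => ⟪tangent γ t, n t⟫) = fun _ => (0 : ℝ) := by
    funext t
    rw [tangent, real_inner_smul_left, horth, mul_zero]
  rw [h2, deriv_const, tangent, real_inner_smul_left] at h1
  have h3 : kappa2 γ n θ = -((speed γ θ)⁻¹ * ⟪deriv γ θ, deriv n θ⟫) := by
    rw [kappa2]
    linarith
  rw [h3]
  field_simp

lemma hasDerivAt_normalize (hN : HasDerivAt N N' θ) (h0 : N θ ≠ 0) :
    HasDerivAt (fun t => ‖N t‖⁻¹ • N t)
      (‖N θ‖⁻¹ • N' - (⟪N θ, N'⟫ / ‖N θ‖ ^ 3) • N θ) θ := by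
  have hne : ‖N θ‖ ≠ 0 := norm_ne_zero_iff.2 h0
  have h1 : HasDerivAt (fun t => ‖N t‖) (⟪N θ, N'⟫ / ‖N θ‖) θ := by
    have := hN.norm_sq.sqrt (pow_ne_zero 2 hne)
    simp only [Real.sqrt_sq (norm_nonneg _)] at this
    convert this using 1
    field_simp
  have h2 := (h1.inv hne).smul hN
  refine h2.congr_deriv ?_
  rw [sub_eq_add_neg, ← neg_smul]
  congr 2
  field_simp

/-- Differentiating the normalising factor only adds a multiple of `N`, which `w` does not see. -/
lemma inner_deriv_normalize (hN : HasDerivAt N N' θ) (h0 : N θ ≠ 0) {w : E3}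
    (hw : ⟪w, N θ⟫ = 0) :
    ⟪w, deriv (fun t => ‖N t‖⁻¹ • N t) θ⟫ = ⟪w, N'⟫ / ‖N θ‖ := by
  rw [(hasDerivAt_normalize hN h0).deriv, inner_sub_right, real_inner_smul_right,
    real_inner_smul_right, hw]
  ring

/-- The derivative is the part of `N'` orthogonal to `N`, divided by `‖N‖`; its squared length is a
Gram determinant over `‖N‖⁴`. -/
lemma inner_deriv_normalize_self (hN : HasDerivAt N N' θ) (h0 : N θ ≠ 0) :
    ⟪deriv (fun t => ‖N t‖⁻¹ • N t) θ, deriv (fun t => ‖N t‖⁻¹ • N t) θ⟫ =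
      (⟪N θ, N θ⟫ * ⟪N', N'⟫ - ⟪N θ, N'⟫ ^ 2) / ⟪N θ, N θ⟫ ^ 2 := by
  have hne : ‖N θ‖ ≠ 0 := norm_ne_zero_iff.2 h0
  rw [(hasDerivAt_normalize hN h0).deriv]
  simp only [inner_sub_right, inner_sub_left, real_inner_smul_right, real_inner_smul_left,
    real_inner_comm (N θ) N', real_inner_self_eq_norm_sq (N θ)]
  field_simp
  ring

end Frame

/-! ### Partial derivatives and their expansions in polar coordinates. -/

/-- The partial derivative in `u`. -/
def du (h : ℝ × ℝ → ℝ) (p : ℝ × ℝ) : ℝ := fderiv ℝ h p (1, 0)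

/-- The partial derivative in `v`. -/
def dv (h : ℝ × ℝ → ℝ) (p : ℝ × ℝ) : ℝ := fderiv ℝ h p (0, 1)

/-- The derivative of `θ ↦ h (polar r θ)`. -/
def dpolar (h : ℝ × ℝ → ℝ) (r θ : ℝ) : ℝ :=
  fderiv ℝ h (polar r θ) (-(r * Real.sin θ), r * Real.cos θ)

lemma hasDerivAt_polar (r θ : ℝ) :
    HasDerivAt (polar r) (-(r * Real.sin θ), r * Real.cos θ) θ := by
  have h1 := (Real.hasDerivAt_cos θ).const_mul r
  rw [mul_neg] at h1
  exact h1.prodMk ((Real.hasDerivAt_sin θ).const_mul r)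

lemma hasDerivAt_dpolar {h : ℝ × ℝ → ℝ} {r θ : ℝ} (hd : DifferentiableAt ℝ h (polar r θ)) :
    HasDerivAt (fun t => h (polar r t)) (dpolar h r θ) θ :=
  hd.hasFDerivAt.comp_hasDerivAt θ (hasDerivAt_polar r θ)

lemma fderiv_apply_eq {h : ℝ × ℝ → ℝ} {p : ℝ × ℝ} (x y : ℝ) :
    fderiv ℝ h p (x, y) = x * du h p + y * dv h p := by
  have : (x, y) = x • ((1, 0) : ℝ × ℝ) + y • ((0, 1) : ℝ × ℝ) := by simp
  rw [this, map_add, map_smul, map_smul, smul_eq_mul, smul_eq_mul, du, dv]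

lemma ContDiffAt.du {h : ℝ × ℝ → ℝ} {p : ℝ × ℝ} (hh : ContDiffAt ℝ ∞ h p) :
    ContDiffAt ℝ ∞ (du h) p :=
  (hh.fderiv_right (m := ∞) (by simp)).clm_apply contDiffAt_const

lemma ContDiffAt.dv {h : ℝ × ℝ → ℝ} {p : ℝ × ℝ} (hh : ContDiffAt ℝ ∞ h p) :
    ContDiffAt ℝ ∞ (dv h) p :=
  (hh.fderiv_right (m := ∞) (by simp)).clm_apply contDiffAt_const

lemma norm_polar_le {r : ℝ} (hr : 0 ≤ r) (θ : ℝ) : ‖polar r θ‖ ≤ r := by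
  rw [polar, Prod.norm_def]
  refine max_le ?_ ?_ <;> simp only [norm_mul, Real.norm_eq_abs, abs_of_nonneg hr]
  · exact mul_le_of_le_one_right hr (Real.abs_cos_le_one θ)
  · exact mul_le_of_le_one_right hr (Real.abs_sin_le_one θ)

lemma norm_polar_isBigO (n : ℕ) :
    (fun q : ℝ × ℝ => ‖polar q.1 q.2‖ ^ n) =O[polarFilter] fun q => q.1 ^ n := by
  refine IsBigO.of_bound' ?_
  filter_upwards [eventually_pos] with q hq
  rw [norm_pow, norm_pow, norm_norm, Real.norm_of_nonneg hq.le]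
  exact pow_le_pow_left₀ (norm_nonneg _) (norm_polar_le hq.le _) n

lemma tendsto_polar : Tendsto (fun q : ℝ × ℝ => polar q.1 q.2) polarFilter (𝓝 0) := by
  rw [tendsto_zero_iff_norm_tendsto_zero]
  have := norm_polar_isBigO 1
  simp only [pow_one] at this
  exact this.trans_tendsto tendsto_fst_polarFilter

lemma lead_of_linear {h : ℝ × ℝ → ℝ} {α β : ℝ}
    (hO : (fun p : ℝ × ℝ => h p - (α * p.1 + β * p.2)) =O[𝓝 0] fun p => ‖p‖ ^ 2) :
    Lead (fun r θ => h (polar r θ)) (fun θ => α * Real.cos θ + β * Real.sin θ) 1 := by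
  refine ⟨⟨|α| + |β|, fun θ => (abs_add_le _ _).trans ?_⟩, ?_⟩
  · rw [abs_mul, abs_mul]
    exact add_le_add (mul_le_of_le_one_right (abs_nonneg _) (Real.abs_cos_le_one θ))
      (mul_le_of_le_one_right (abs_nonneg _) (Real.abs_sin_le_one θ))
  · refine ((hO.comp_tendsto tendsto_polar).trans (norm_polar_isBigO 2)).congr_left fun q => ?_
    simp only [Function.comp_apply, polar]
    ring

/-- The derivative of the error is `O(r)` on the circle, and the velocity of `polar r` is `O(r)`
too, so their pairing is `O(r²)`. -/
lemma lead_dpolar_of_linear {h : ℝ × ℝ → ℝ} {α β : ℝ} (hs : ContDiffAt ℝ ∞ h 0)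
    (hO : (fun p : ℝ × ℝ => h p - (α * p.1 + β * p.2)) =O[𝓝 0] fun p => ‖p‖ ^ 2) :
    Lead (dpolar h) (fun θ => -(α * Real.sin θ) + β * Real.cos θ) 1 := by
  refine ⟨⟨|α| + |β|, fun θ => (abs_add_le _ _).trans ?_⟩, ?_⟩
  · rw [abs_neg, abs_mul, abs_mul]
    exact add_le_add (mul_le_of_le_one_right (abs_nonneg _) (Real.abs_sin_le_one θ))
      (mul_le_of_le_one_right (abs_nonneg _) (Real.abs_cos_le_one θ))
  · let L : ℝ × ℝ →L[ℝ] ℝ :=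
      α • ContinuousLinearMap.fst ℝ ℝ ℝ + β • ContinuousLinearMap.snd ℝ ℝ ℝ
    have hL : ∀ p : ℝ × ℝ, L p = α * p.1 + β * p.2 := fun p => by simp [L]
    have h1 : fderiv ℝ (fun p => h p - L p) =O[𝓝 0] fun p => ‖p‖ :=
      fderiv_isBigO_of_isBigO_sq ((hs.of_le (by norm_cast)).sub L.contDiff.contDiffAt)
        (by simpa only [hL] using hO)
    have hd : ∀ᶠ p in 𝓝 (0 : ℝ × ℝ), DifferentiableAt ℝ h p :=
      ((hs.of_le (m := 1) (by simp)).eventually (by simp)).mono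
        fun p hp => hp.differentiableAt (by norm_num)
    have h2 : (fun p => fderiv ℝ h p - L) =O[𝓝 0] fun p => ‖p‖ := by
      refine h1.congr' ?_ EventuallyEq.rfl
      filter_upwards [hd] with p hp
      rw [fderiv_fun_sub hp L.differentiableAt, L.fderiv]
    have h3 := (h2.comp_tendsto tendsto_polar).trans
      ((norm_polar_isBigO 1).congr_left fun q => pow_one _)
    have h4 : (fun q : ℝ × ℝ => ((-(q.1 * Real.sin q.2), q.1 * Real.cos q.2) : ℝ × ℝ))
        =O[polarFilter] fun q => q.1 ^ 1 := by
      refine (isBigO_of_le _ fun q => ?_ : _ =O[polarFilter] fun q : ℝ × ℝ => q.1).congr_right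
        fun q => (pow_one _).symm
      rw [Prod.norm_def]
      refine max_le ?_ ?_
      · simpa [abs_mul] using mul_le_of_le_one_right (abs_nonneg q.1) (Real.abs_sin_le_one q.2)
      · simpa [abs_mul] using mul_le_of_le_one_right (abs_nonneg q.1) (Real.abs_cos_le_one q.2)
    have h5 := (h3.norm_left.mul h4.norm_left)
    refine (IsBigO.trans (isBigO_of_le _ fun q => ?_) h5).congr_right fun q => by ring
    have h6 : dpolar h q.1 q.2 - (-(α * Real.sin q.2) + β * Real.cos q.2) * q.1 ^ 1 =
        (fderiv ℝ h (polar q.1 q.2) - L) (-(q.1 * Real.sin q.2), q.1 * Real.cos q.2) := by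
      rw [sub_apply, hL, dpolar]
      ring
    rw [h6, norm_mul, norm_norm, norm_norm]
    exact ContinuousLinearMap.le_opNorm _ _

lemma du_dv_isBigO {h : ℝ × ℝ → ℝ} {A B C : ℝ} (hs : ContDiffAt ℝ ∞ h 0)
    (hO : (fun p : ℝ × ℝ => h p - (A / 2 * p.1 ^ 2 + B * (p.1 * p.2) + C / 2 * p.2 ^ 2))
      =O[𝓝 0] fun p => ‖p‖ ^ 3) :
    ((fun p : ℝ × ℝ => du h p - (A * p.1 + B * p.2)) =O[𝓝 0] fun p => ‖p‖ ^ 2) ∧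
    (fun p : ℝ × ℝ => dv h p - (B * p.1 + C * p.2)) =O[𝓝 0] fun p => ‖p‖ ^ 2 := by
  set Q : ℝ × ℝ → ℝ := fun p => A / 2 * p.1 ^ 2 + B * (p.1 * p.2) + C / 2 * p.2 ^ 2 with hQ
  have hQd : ∀ p : ℝ × ℝ, HasFDerivAt Q
      ((A * p.1 + B * p.2) • ContinuousLinearMap.fst ℝ ℝ ℝ +
        (B * p.1 + C * p.2) • ContinuousLinearMap.snd ℝ ℝ ℝ) p := by
    intro p
    have e1 : HasFDerivAt (fun p : ℝ × ℝ => p.1) _ p := hasFDerivAt_fst (𝕜 := ℝ)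
    have e2 : HasFDerivAt (fun p : ℝ × ℝ => p.2) _ p := hasFDerivAt_snd (𝕜 := ℝ)
    have e := (((e1.pow 2).const_mul (A / 2)).add ((e1.mul e2).const_mul B)).add
      ((e2.pow 2).const_mul (C / 2))
    refine e.congr_fderiv ?_
    ext <;> simp <;> ring
  have hQc : ContDiff ℝ 3 Q := by
    rw [hQ]
    fun_prop
  have h1 : fderiv ℝ (fun p => h p - Q p) =O[𝓝 0] fun p => ‖p‖ ^ 2 :=
    fderiv_isBigO_of_isBigO_cube ((hs.of_le (by norm_cast)).sub hQc.contDiffAt) hO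
  have hd : ∀ᶠ p in 𝓝 (0 : ℝ × ℝ), DifferentiableAt ℝ h p :=
    ((hs.of_le (m := 1) (by simp)).eventually (by simp)).mono
      fun p hp => hp.differentiableAt (by norm_num)
  have happ : ∀ w : ℝ × ℝ, (fun p => fderiv ℝ (fun p => h p - Q p) p w) =O[𝓝 0]
      fun p => ‖p‖ ^ 2 := fun w =>
    (((ContinuousLinearMap.apply ℝ ℝ w).isBigO_comp _ _).trans h1)
  constructor
  · refine (happ (1, 0)).congr' ?_ EventuallyEq.rfl
    filter_upwards [hd] with p hp
    rw [fderiv_fun_sub hp (hQd p).differentiableAt, (hQd p).fderiv]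
    simp [du]
  · refine (happ (0, 1)).congr' ?_ EventuallyEq.rfl
    filter_upwards [hd] with p hp
    rw [fderiv_fun_sub hp (hQd p).differentiableAt, (hQd p).fderiv]
    simp [dv]

/-! ### Exact formulas along a fixed circle. -/

/-- The `i`-th component of `f`. -/
def component (f : ℝ × ℝ → E3) (i : Fin 3) (p : ℝ × ℝ) : ℝ := f p i

/-- `f` is smooth near `p`, with first component `u` there. -/
def IsAdapted (f : ℝ × ℝ → E3) (p : ℝ × ℝ) : Prop :=
  ContDiffAt ℝ ∞ f p ∧ component f 0 =ᶠ[𝓝 p] Prod.fst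

/-- The components of `f_u × f_v` along the circle of radius `r`. -/
def normalVec (f : ℝ × ℝ → E3) (r θ : ℝ) : E3 :=
  !₂[du (component f 1) (polar r θ) * dv (component f 2) (polar r θ) -
      du (component f 2) (polar r θ) * dv (component f 1) (polar r θ),
    -dv (component f 2) (polar r θ), dv (component f 1) (polar r θ)]

/-- The derivative in `θ` of `normalVec f r θ`. -/
def dnormalVec (f : ℝ × ℝ → E3) (r θ : ℝ) : E3 :=
  !₂[(dpolar (du (component f 1)) r θ * dv (component f 2) (polar r θ) +
      du (component f 1) (polar r θ) * dpolar (dv (component f 2)) r θ) -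
      (dpolar (du (component f 2)) r θ * dv (component f 1) (polar r θ) +
      du (component f 2) (polar r θ) * dpolar (dv (component f 1)) r θ),
    -dpolar (dv (component f 2)) r θ, dpolar (dv (component f 1)) r θ]

/-- The derivative in `θ` of `curve f r θ`. -/
def dcurve (f : ℝ × ℝ → E3) (r θ : ℝ) : E3 :=
  !₂[-(r * Real.sin θ),
    -(r * Real.sin θ) * du (component f 1) (polar r θ) +
      r * Real.cos θ * dv (component f 1) (polar r θ),
    -(r * Real.sin θ) * du (component f 2) (polar r θ) +
      r * Real.cos θ * dv (component f 2) (polar r θ)]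

lemma inner_eq_sum (x y : E3) : ⟪x, y⟫ = x 0 * y 0 + x 1 * y 1 + x 2 * y 2 := by
  simp only [PiLp.inner_apply, Fin.sum_univ_three, RCLike.inner_apply, conj_trivial]
  ring

lemma hasDerivAt_E3 {γ : ℝ → E3} {γ' : E3} {θ : ℝ}
    (h : ∀ i, HasDerivAt (fun t => γ t i) (γ' i) θ) : HasDerivAt γ γ' θ := by
  rw [hasDerivAt_iff_hasFDerivAt, ← hasFDerivWithinAt_univ, hasFDerivWithinAt_euclidean]
  intro i
  rw [hasFDerivWithinAt_univ]
  refine (h i).hasFDerivAt.congr_fderiv ?_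
  ext
  simp

section Fixed

variable {f : ℝ × ℝ → E3} {r : ℝ}

lemma ContDiffAt.component {p : ℝ × ℝ} (h : ContDiffAt ℝ ∞ f p) (i : Fin 3) :
    ContDiffAt ℝ ∞ (component f i) p :=
  contDiffAt_euclidean.1 h i

lemma differentiableAt_of_smooth {h : ℝ × ℝ → ℝ} {p : ℝ × ℝ} (hh : ContDiffAt ℝ ∞ h p) :
    DifferentiableAt ℝ h p :=
  hh.differentiableAt (by simp)

lemma fderiv_component {p : ℝ × ℝ} (h : ContDiffAt ℝ ∞ f p) (w : ℝ × ℝ) (i : Fin 3) :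
    fderiv ℝ f p w i = fderiv ℝ (component f i) p w := by
  have h1 := (EuclideanSpace.proj i : E3 →L[ℝ] ℝ).hasFDerivAt.comp p
    (h.differentiableAt (by simp)).hasFDerivAt
  have h2 : HasFDerivAt (component f i) _ p := h1
  rw [h2.fderiv]
  rfl

lemma fderiv_component_zero {p : ℝ × ℝ} (h : IsAdapted f p) :
    fderiv ℝ (component f 0) p = ContinuousLinearMap.fst ℝ ℝ ℝ := by
  rw [h.2.fderiv_eq, fderiv_fst]

lemma normal_polar {θ : ℝ} (h : IsAdapted f (polar r θ)) :
    normal f (polar r θ) = normalVec f r θ := by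
  ext i
  fin_cases i <;>
    simp [normal, cross, cross_apply, normalVec, fderiv_component h.1, fderiv_component_zero h,
      du, dv]

lemma hasDerivAt_curve {θ : ℝ} (h : IsAdapted f (polar r θ)) :
    HasDerivAt (curve f r) (dcurve f r θ) θ := by
  have h1 : HasDerivAt (curve f r) _ θ :=
    (h.1.differentiableAt (by simp)).hasFDerivAt.comp_hasDerivAt θ (hasDerivAt_polar r θ)
  refine h1.congr_deriv ?_
  ext i
  rw [fderiv_component h.1]
  fin_cases i
  · simp [fderiv_component_zero h, dcurve]
  · simp [fderiv_apply_eq, dcurve]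
  · simp [fderiv_apply_eq, dcurve]

lemma hasDerivAt_normalVec {θ : ℝ} (h : IsAdapted f (polar r θ)) :
    HasDerivAt (normalVec f r) (dnormalVec f r θ) θ := by
  have hu : ∀ i, HasDerivAt (fun t => du (component f i) (polar r t))
      (dpolar (du (component f i)) r θ) θ := fun i =>
    hasDerivAt_dpolar (differentiableAt_of_smooth (ContDiffAt.du (ContDiffAt.component h.1 i)))
  have hv : ∀ i, HasDerivAt (fun t => dv (component f i) (polar r t))
      (dpolar (dv (component f i)) r θ) θ := fun i =>
    hasDerivAt_dpolar (differentiableAt_of_smooth (ContDiffAt.dv (ContDiffAt.component h.1 i)))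
  refine hasDerivAt_E3 fun i => ?_
  fin_cases i
  · exact ((hu 1).mul (hv 2)).sub ((hu 2).mul (hv 1))
  · exact (hv 2).neg
  · exact hv 1

lemma differentiableAt_dcurve {θ : ℝ} (h : IsAdapted f (polar r θ)) :
    DifferentiableAt ℝ (dcurve f r) θ := by
  have hu : ∀ i, DifferentiableAt ℝ (fun t => du (component f i) (polar r t)) θ := fun i =>
    (hasDerivAt_dpolar (differentiableAt_of_smooth
      (ContDiffAt.du (ContDiffAt.component h.1 i)))).differentiableAt
  have hv : ∀ i, DifferentiableAt ℝ (fun t => dv (component f i) (polar r t)) θ := fun i =>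
    (hasDerivAt_dpolar (differentiableAt_of_smooth
      (ContDiffAt.dv (ContDiffAt.component h.1 i)))).differentiableAt
  have hs : DifferentiableAt ℝ (fun t => -(r * Real.sin t)) θ := by fun_prop
  have hc : DifferentiableAt ℝ (fun t => r * Real.cos t) θ := by fun_prop
  refine differentiableAt_euclidean.2 fun i => ?_
  fin_cases i
  · exact hs
  · exact (hs.mul (hu 1)).add (hc.mul (hv 1))
  · exact (hs.mul (hu 2)).add (hc.mul (hv 2))

lemma inner_dcurve_normalVec (θ : ℝ) : ⟪dcurve f r θ, normalVec f r θ⟫ = 0 := by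
  simp only [inner_eq_sum, dcurve, normalVec, Matrix.cons_val]
  ring

/-- A zero velocity forces `sin θ = 0` by its first component, hence `cos θ ≠ 0`; then both
`v`-partials vanish, and every entry of the normal contains one of them. -/
lemma dcurve_ne_zero (hr : 0 < r) {θ : ℝ} (h0 : normalVec f r θ ≠ 0) : dcurve f r θ ≠ 0 := by
  intro h
  have e0 := congrArg (fun x : E3 => x 0) h
  have e1 := congrArg (fun x : E3 => x 1) h
  have e2 := congrArg (fun x : E3 => x 2) h
  simp only [dcurve, PiLp.toLp_apply, Matrix.cons_val, PiLp.zero_apply] at e0 e1 e2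
  have hs : r * Real.sin θ = 0 := neg_eq_zero.1 e0
  have hs' : Real.sin θ = 0 := (mul_eq_zero.1 hs).resolve_left hr.ne'
  have hc : Real.cos θ ≠ 0 := fun hc => by
    have := Real.sin_sq_add_cos_sq θ
    rw [hs', hc] at this
    norm_num at this
  have hrc : r * Real.cos θ ≠ 0 := mul_ne_zero hr.ne' hc
  rw [hs, neg_zero, zero_mul, zero_add] at e1 e2
  have v1 := (mul_eq_zero.1 e1).resolve_left hrc
  have v2 := (mul_eq_zero.1 e2).resolve_left hrc
  apply h0
  ext i
  fin_cases i <;> simp [normalVec, v1, v2]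


lemma deriv_curve (hg : ∀ t, IsAdapted f (polar r t)) : deriv (curve f r) = dcurve f r :=
  funext fun t => (hasDerivAt_curve (hg t)).deriv

lemma normalAlong_eq (hg : ∀ t, IsAdapted f (polar r t)) :
    normalAlong f r = fun t => ‖normalVec f r t‖⁻¹ • normalVec f r t :=
  funext fun t => by rw [normalAlong, unitNormal, normal_polar (hg t)]

lemma inner_deriv_curve_normalAlong (hg : ∀ t, IsAdapted f (polar r t)) {θ : ℝ}
    (h0 : normalVec f r θ ≠ 0) :
    ⟪deriv (curve f r) θ, deriv (normalAlong f r) θ⟫ =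
      ⟪dcurve f r θ, dnormalVec f r θ⟫ / √⟪normalVec f r θ, normalVec f r θ⟫ := by
  rw [deriv_curve hg, normalAlong_eq hg, ← norm_eq_sqrt_real_inner]
  exact inner_deriv_normalize (hasDerivAt_normalVec (hg θ)) h0 (inner_dcurve_normalVec θ)

lemma kappaHat2_eq (hr : 0 < r) (hg : ∀ t, IsAdapted f (polar r t)) {θ : ℝ}
    (h0 : normalVec f r θ ≠ 0) :
    kappaHat2 f r θ =
      -(⟪dcurve f r θ, dnormalVec f r θ⟫ / √⟪normalVec f r θ, normalVec f r θ⟫) := by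
  rw [← inner_deriv_curve_normalAlong hg h0, kappaHat2]
  refine speed_mul_kappa2 ?_ ?_ ?_ fun t => ?_
  · rw [deriv_curve hg]
    exact differentiableAt_dcurve (hg θ)
  · rw [deriv_curve hg]
    exact dcurve_ne_zero hr h0
  · rw [normalAlong_eq hg]
    exact (hasDerivAt_normalize (hasDerivAt_normalVec (hg θ)) h0).differentiableAt
  · rw [deriv_curve hg, normalAlong_eq hg, real_inner_smul_right, inner_dcurve_normalVec, mul_zero]

lemma beta_eq (hr : 0 < r) (hg : ∀ t, IsAdapted f (polar r t)) {θ : ℝ}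
    (h0 : normalVec f r θ ≠ 0) :
    beta f r θ = kappaHat2 f r θ * ⟪normalVec f r θ, normalVec f r θ⟫ ^ 2 /
      (⟪normalVec f r θ, normalVec f r θ⟫ * ⟪dnormalVec f r θ, dnormalVec f r θ⟫ -
        ⟪normalVec f r θ, dnormalVec f r θ⟫ ^ 2) := by
  rw [beta, strictionCoeff, inner_deriv_curve_normalAlong hg h0, kappaHat2_eq hr hg h0,
    normalAlong_eq hg, inner_deriv_normalize_self (hasDerivAt_normalVec (hg θ)) h0,
    div_div_eq_mul_div]
  ring

end Fixed

/-! ### The 2-jet of the normal form. -/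

namespace IsNormalForm

variable {k : ℕ} {a : ℕ → ℕ → ℝ} {b : ℕ → ℝ} {f : ℝ × ℝ → E3}

lemma eventually_isAdapted (hf : IsNormalForm k a b f) :
    ∀ᶠ p in 𝓝 (0 : ℝ × ℝ), IsAdapted f p := by
  obtain ⟨U, hU, hs⟩ := hf.smooth
  filter_upwards [eventually_eventually_nhds.2 hf.fst_eq, interior_mem_nhds.2 hU] with p h1 h2
  exact ⟨hs.contDiffAt (mem_interior_iff_mem_nhds.1 h2), h1⟩

/-- The whole circle is needed at once, since the formulas for `curve f r` and `normalAlong f r` are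
identities of functions of the angle. -/
lemma eventually_forall_isAdapted (hf : IsNormalForm k a b f) :
    ∀ᶠ q in polarFilter, ∀ t, IsAdapted f (polar q.1 t) := by
  refine eventually_polarFilter.2 ?_
  filter_upwards [eventually_polarFilter.1 (tendsto_polar.eventually hf.eventually_isAdapted)]
    with r hr _ using hr

lemma norm_pow_isBigO {m n : ℕ} (h : m ≤ n) :
    (fun p : ℝ × ℝ => ‖p‖ ^ n) =O[𝓝 0] fun p => ‖p‖ ^ m := by
  refine IsBigO.of_bound' ?_
  filter_upwards [Metric.ball_mem_nhds (0 : ℝ × ℝ) one_pos] with p hp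
  rw [norm_pow, norm_pow, norm_norm]
  exact pow_le_pow_of_le_one (norm_nonneg _) (mem_ball_zero_iff.1 hp).le h

lemma monomial_isBigO (c : ℝ) (i j : ℕ) (h : 3 ≤ i + j) :
    (fun p : ℝ × ℝ => c * p.1 ^ i * p.2 ^ j) =O[𝓝 0] fun p => ‖p‖ ^ 3 := by
  have h1 : (fun p : ℝ × ℝ => p.1) =O[𝓝 0] fun p => ‖p‖ := isBigO_of_le _ fun p => by
    simpa using norm_fst_le p
  have h2 : (fun p : ℝ × ℝ => p.2) =O[𝓝 0] fun p => ‖p‖ := isBigO_of_le _ fun p => by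
    simpa using norm_snd_le p
  refine IsBigO.trans ?_ (norm_pow_isBigO h)
  refine ((((h1.pow i).const_mul_left c).mul (h2.pow j))).congr_right fun p => ?_
  rw [pow_add]

lemma component_one (hf : IsNormalForm k a b f) (hk : 3 ≤ k) :
    (fun p : ℝ × ℝ => component f 1 p - (0 / 2 * p.1 ^ 2 + 1 * (p.1 * p.2) + 0 / 2 * p.2 ^ 2))
      =O[𝓝 0] fun p => ‖p‖ ^ 3 := by
  have h1 := hf.snd_eq.trans (norm_pow_isBigO (m := 3) (by lia))
  have h2 : (fun p : ℝ × ℝ => ∑ i ∈ Finset.Icc 3 k, b i / (i.factorial : ℝ) * p.2 ^ i)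
      =O[𝓝 0] fun p => ‖p‖ ^ 3 := by
    apply IsBigO.fun_sum
    intro i hi
    simpa using monomial_isBigO (b i / (i.factorial : ℝ)) 0 i (by
      simpa using (Finset.mem_Icc.1 hi).1)
  refine (h1.add h2).congr_left fun p => ?_
  rw [component]
  ring

lemma component_two (hf : IsNormalForm k a b f) (hk : 3 ≤ k) :
    (fun p : ℝ × ℝ => component f 2 p -
        (a 2 0 / 2 * p.1 ^ 2 + a 1 1 * (p.1 * p.2) + a 0 2 / 2 * p.2 ^ 2))
      =O[𝓝 0] fun p => ‖p‖ ^ 3 := by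
  have h1 := hf.thd_eq.trans (norm_pow_isBigO (m := 3) (by lia))
  have h2 : (fun p : ℝ × ℝ => ∑ j ∈ Finset.Icc 3 k, ∑ i ∈ Finset.range (j + 1),
        a i (j - i) / ((i.factorial : ℝ) * ((j - i).factorial : ℝ)) * p.1 ^ i * p.2 ^ (j - i))
      =O[𝓝 0] fun p => ‖p‖ ^ 3 := by
    apply IsBigO.fun_sum
    intro j hj
    apply IsBigO.fun_sum
    intro i hi
    have := (Finset.mem_Icc.1 hj).1
    have := Finset.mem_range.1 hi
    exact monomial_isBigO _ _ _ (by lia)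
  refine (h1.add h2).congr_left fun p => ?_
  rw [component, ← Finset.add_sum_Ioc_eq_sum_Icc (show 2 ≤ k by lia),
    ← Finset.Icc_add_one_left_eq_Ioc]
  simp [Finset.sum_range_succ]
  ring

end IsNormalForm

/-! ### Nondegeneracy of `𝒜` and of `F_{κ̂₂}`. -/

lemma exists_le_calA_sq (a : ℕ → ℕ → ℝ) (ha : 0 < a 0 2) :
    ∃ δ > 0, ∀ θ, δ ≤ Real.cos θ ^ 2 + (a 1 1 * Real.cos θ + a 0 2 * Real.sin θ) ^ 2 := by
  -- With `c = cos θ` and `w = a₁₁ c + a₀₂ sin θ`, this comes from `a₀₂² = a₀₂² c² + (w - a₁₁ c)² ≤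
  -- (a₀₂² + 2 a₁₁² + 2)(c² + w²)`.
  refine ⟨a 0 2 ^ 2 / (a 0 2 ^ 2 + 2 * a 1 1 ^ 2 + 2), by positivity, fun θ => ?_⟩
  rw [div_le_iff₀ (by positivity)]
  set c := Real.cos θ
  set w := a 1 1 * c + a 0 2 * Real.sin θ with hw
  have h1 : a 0 2 ^ 2 = a 0 2 ^ 2 * c ^ 2 + (w - a 1 1 * c) ^ 2 := by
    rw [hw]
    linear_combination (-a 0 2 ^ 2) * Real.sin_sq_add_cos_sq θ
  have h2 : (w - a 1 1 * c) ^ 2 ≤ 2 * w ^ 2 + 2 * (a 1 1 * c) ^ 2 := by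
    linarith [sq_nonneg (w + a 1 1 * c)]
  have h3 : 0 ≤ a 0 2 ^ 2 * w ^ 2 + 2 * a 1 1 ^ 2 * w ^ 2 + 2 * c ^ 2 := by positivity
  linarith

lemma calA_pos (a : ℕ → ℕ → ℝ) (ha : 0 < a 0 2) (θ : ℝ) : 0 < calA a θ := by
  obtain ⟨δ, hδ, h⟩ := exists_le_calA_sq a ha
  exact Real.sqrt_pos.2 (hδ.trans_le (h θ))

/-- Witness that `F_{κ̂₂}` is not identically zero, as `IsFirstTerm` and the uniqueness argument
require. -/
lemma FkappaHat2_zero (a : ℕ → ℕ → ℝ) : FkappaHat2 a 0 = a 0 2 := by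
  simp [FkappaHat2]

/-! ### Leading terms of the geometric quantities. -/

namespace IsNormalForm

variable {k : ℕ} {a : ℕ → ℕ → ℝ} {b : ℕ → ℝ} {f : ℝ × ℝ → E3}

/-- The leading terms of the inner products from which `κ̂₂` and `β` are built. -/
lemma lead_inner (hf : IsNormalForm k a b f) (hk : 3 ≤ k) :
    Lead (fun r θ => ⟪normalVec f r θ, normalVec f r θ⟫)
      (fun θ => Real.cos θ ^ 2 + (a 1 1 * Real.cos θ + a 0 2 * Real.sin θ) ^ 2) 2 ∧
    Lead (fun r θ => ⟪dcurve f r θ, dnormalVec f r θ⟫) (fun θ => -FkappaHat2 a θ) 3 ∧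
    Lead (fun r θ => ⟪normalVec f r θ, normalVec f r θ⟫ * ⟪dnormalVec f r θ, dnormalVec f r θ⟫ -
      ⟪normalVec f r θ, dnormalVec f r θ⟫ ^ 2) (fun _ => a 0 2 ^ 2) 4 := by
  have hs : ∀ i, ContDiffAt ℝ ∞ (component f i) 0 := fun i =>
    ContDiffAt.component hf.eventually_isAdapted.self_of_nhds.1 i
  obtain ⟨ou1, ov1⟩ := du_dv_isBigO (hs 1) (hf.component_one hk)
  obtain ⟨ou2, ov2⟩ := du_dv_isBigO (hs 2) (hf.component_two hk)
  have u1 := lead_of_linear ou1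
  have v1 := lead_of_linear ov1
  have u2 := lead_of_linear ou2
  have v2 := lead_of_linear ov2
  have u1' := lead_dpolar_of_linear (ContDiffAt.du (hs 1)) ou1
  have v1' := lead_dpolar_of_linear (ContDiffAt.dv (hs 1)) ov1
  have u2' := lead_dpolar_of_linear (ContDiffAt.du (hs 2)) ou2
  have v2' := lead_dpolar_of_linear (ContDiffAt.dv (hs 2)) ov2
  have rs : Lead (fun r θ => -(r * Real.sin θ)) _ 1 := (Lead.radius.mul Lead.sin).neg
  have rc : Lead (fun r θ => r * Real.cos θ) _ 1 := Lead.radius.mul Lead.cos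
  have n0 := (u1.mul v2).sub (u2.mul v1)
  have n0' := ((u1'.mul v2).add (u1.mul v2')).sub ((u2'.mul v1).add (u2.mul v1'))
  have g1 := (rs.mul u1).add (rc.mul v1)
  have g2 := (rs.mul u2).add (rc.mul v2)
  -- The first entry of `N` has order `r²`, one more than the others, so it counts as `0` at order
  -- `r`. In `T` below, its derivative keeps its full order, as it is paired there with `-r sin θ`.
  have S := ((n0.lower.mul n0.lower).add (v2.neg.mul v2.neg)).add (v1.mul v1)
  have J := ((n0'.lower.mul n0'.lower).add (v2'.neg.mul v2'.neg)).add (v1'.mul v1')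
  have I := ((n0.lower.mul n0'.lower).add (v2.neg.mul v2'.neg)).add (v1.mul v1')
  have T := ((rs.mul n0').add (g1.mul v2'.neg)).add (g2.mul v1')
  refine ⟨S.congr' (Eventually.of_forall fun q => ?_) fun θ => ?_,
    T.congr' (Eventually.of_forall fun q => ?_) fun θ => ?_,
    ((S.mul J).sub I.pow_two).congr' (Eventually.of_forall fun q => ?_) fun θ => ?_⟩
  · simp only [inner_eq_sum, normalVec, Matrix.cons_val]
  · ring
  · simp only [inner_eq_sum, dcurve, dnormalVec, Matrix.cons_val]
  · rw [FkappaHat2]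
    ring
  · simp only [inner_eq_sum, normalVec, dnormalVec, Matrix.cons_val]
  -- The coefficient is `a₀₂² (sin² θ + cos² θ)²`, the square of the Wronskian; `X² - 1 = (X + 1)(X
  -- - 1)` with `X = sin² θ + cos² θ`.
  · linear_combination a 0 2 ^ 2 * (Real.sin θ ^ 2 + Real.cos θ ^ 2 + 1) *
      Real.sin_sq_add_cos_sq θ

lemma lead_kappaHat2_beta (hf : IsNormalForm k a b f) (hk : 3 ≤ k) :
    Lead (kappaHat2 f) (fun θ => FkappaHat2 a θ / calA a θ) 2 ∧
    Lead (beta f) (fun θ => FkappaHat2 a θ * calA a θ ^ 3 / a 0 2 ^ 2) 2 := by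
  obtain ⟨S, T, D⟩ := hf.lead_inner hk
  obtain ⟨δ, hδ, hA⟩ := exists_le_calA_sq a hf.a02_pos
  have hδ' : 0 < √δ := Real.sqrt_pos.2 hδ
  have hA' : ∀ θ, √δ ≤ √(Real.cos θ ^ 2 + (a 1 1 * Real.cos θ + a 0 2 * Real.sin θ) ^ 2) :=
    fun θ => Real.sqrt_le_sqrt (hA θ)
  have hN : ∀ᶠ q in polarFilter, normalVec f q.1 q.2 ≠ 0 := by
    filter_upwards [S.eventually_pos hδ hA] with q hq h0
    simp [h0] at hq
  have K := (T.div (m := 2) (S.sqrt (n := 1) hδ hA) hδ' hA').neg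
  have K' : Lead (kappaHat2 f) (fun θ => FkappaHat2 a θ / calA a θ) 2 := by
    refine K.congr' ?_ fun θ => ?_
    · filter_upwards [hN, eventually_pos, hf.eventually_forall_isAdapted] with q h1 h2 h3
      exact (kappaHat2_eq h2 h3 h1).symm
    · rw [neg_div, neg_neg, calA]
  refine ⟨K', ?_⟩
  have h02 : 0 < a 0 2 ^ 2 := pow_pos hf.a02_pos 2
  -- The orders balance as `2 + 4 - 4 = 2`.
  refine ((K'.mul S.pow_two).div (m := 2) D h02 fun _ => le_rfl).congr' ?_ fun θ => ?_
  · filter_upwards [hN, eventually_pos, hf.eventually_forall_isAdapted] with q h1 h2 h3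
    exact (beta_eq h2 h3 h1).symm
  · have hp := calA_pos a hf.a02_pos θ
    have hsq : Real.cos θ ^ 2 + (a 1 1 * Real.cos θ + a 0 2 * Real.sin θ) ^ 2 = calA a θ ^ 2 :=
      (Real.sq_sqrt (by positivity)).symm
    rw [hsq]
    field_simp

end IsNormalForm

end WhitneyUmbrella

end

/-! ### Comparison of the two first terms. -/

theorem mainTheorem5 (k : ℕ) (hk : 3 ≤ k) (a : ℕ → ℕ → ℝ) (b : ℕ → ℝ)
    (f : ℝ × ℝ → WhitneyUmbrella.E3) (hf : WhitneyUmbrella.IsNormalForm k a b f) :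
    WhitneyUmbrella.HasLeadingTerm (WhitneyUmbrella.kappaHat2 f)
      (fun θ => WhitneyUmbrella.FkappaHat2 a θ / WhitneyUmbrella.calA a θ) 2 ∧
    WhitneyUmbrella.IsFirstTerm (WhitneyUmbrella.kappaHat2 f) (WhitneyUmbrella.FkappaHat2 a) ∧
    WhitneyUmbrella.HasLeadingTerm (WhitneyUmbrella.beta f)
      (fun θ => Real.cos θ * (a 0 2 * Real.cos θ ^ 2 + (2 * a 0 2 + a 2 0) * Real.sin θ ^ 2)
        * WhitneyUmbrella.calA a θ ^ 3 / a 0 2 ^ 2) 2 ∧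
    (∃ Fβ : ℝ → ℝ, WhitneyUmbrella.IsFirstTerm (WhitneyUmbrella.beta f) Fβ) ∧
    ∀ Fβ : ℝ → ℝ, WhitneyUmbrella.IsFirstTerm (WhitneyUmbrella.beta f) Fβ →
      ∀ θ : ℝ, WhitneyUmbrella.FkappaHat2 a θ = 0 ↔ Fβ θ = 0 := by
  obtain ⟨hκ, hβ⟩ := hf.lead_kappaHat2_beta hk
  have hA : ∀ θ, WhitneyUmbrella.calA a θ ≠ 0 := fun θ =>
    (WhitneyUmbrella.calA_pos a hf.a02_pos θ).ne'
  have h02 : a 0 2 ≠ 0 := hf.a02_pos.ne'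
  have hF : WhitneyUmbrella.FkappaHat2 a ≠ 0 := Function.ne_iff.2
    ⟨0, by simpa [WhitneyUmbrella.FkappaHat2_zero] using h02⟩
  have hx : ∀ θ, WhitneyUmbrella.calA a θ ^ 3 / a 0 2 ^ 2 ≠ 0 := fun θ =>
    div_ne_zero (pow_ne_zero 3 (hA θ)) (pow_ne_zero 2 h02)
  have hG : (fun θ => WhitneyUmbrella.FkappaHat2 a θ * WhitneyUmbrella.calA a θ ^ 3 / a 0 2 ^ 2)
      ≠ 0 := Function.ne_iff.2 ⟨0, by
    rw [mul_div_assoc, WhitneyUmbrella.FkappaHat2_zero]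
    exact mul_ne_zero h02 (hx 0)⟩
  refine ⟨hκ.hasLeadingTerm,
    ⟨hF, 2, fun θ => (WhitneyUmbrella.calA a θ)⁻¹, fun θ => inv_ne_zero (hA θ), fun θ => ?_⟩,
    hβ.hasLeadingTerm,
    ⟨WhitneyUmbrella.FkappaHat2 a, hF, 2, fun θ => WhitneyUmbrella.calA a θ ^ 3 / a 0 2 ^ 2, hx,
      fun θ => ?_⟩, fun Fβ hFβ θ => ?_⟩
  · simpa only [div_eq_mul_inv] using hκ.hasLeadingTerm.isBigO θ
  · simpa only [mul_div_assoc] using hβ.hasLeadingTerm.isBigO θ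
  · rw [← hβ.hasLeadingTerm.eq_zero_iff hG hFβ θ, mul_div_assoc, mul_eq_zero,
      or_iff_left (hx θ)]
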